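/- Let $k$ be an algebraically closed field of characteristic $p>0$, let $q=p^e$ with $e\ge 1$, and let $h\in k[x_1,\dots,x_N]$ be a Frobenius form of degree $q+1$, that is, a form of degree $q+1$ lying in the ideal $\langle x_1^q,\dots,x_N^q\rangle$. There is a unique $N\times N$ matrix $A$ over $k$ representing $h$, in the sense that $$h=\begin{bmatrix}x_1^q&\cdots&x_N^q\end{bmatrix}A\begin{bmatrix}x_1&\cdots&x_N\end{bmatrix}^{tr};$$ let $r$ be the rank of $A$ (the rank of $h$). Let $n$ be the embedding dimension of $h$, that is, the least number of variables in which $h$ can be written after an invertible linear change of coordinates. Then, after some invertible linear change of the coordinates $x_1,\dots,x_N$, the form $h$ is represented by a matrix $B$ with the following properties: 1. All rows of $B$ beyond the $r$-th are zero. 2. All columns of $B$ beyond the $n$-th are zero. 3. $B$ has exactly $r$ non-zero entries, all equal to $1$, and they occur in positions $(1,j_1),(2,j_2),\dots,(r,j_r)$ with $j_1>j_2>\dots>j_r$. -/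

import Mathlib

namespace FrobeniusForms

open MvPolynomial

variable {k : Type*} [Field k] {N : ℕ}

/-- A Frobenius form with exponent `q` (in applications, `q = p ^ e` is a power of the
characteristic): a form of degree `q + 1` lying in the ideal `⟨x₁^q, …, x_N^q⟩`. -/
def IsFrobeniusForm (q : ℕ) (h : MvPolynomial (Fin N) k) : Prop :=
  h.IsHomogeneous (q + 1) ∧
    h ∈ Ideal.span (Set.range fun i : Fin N => (X i : MvPolynomial (Fin N) k) ^ q)

/-- The polynomial `(x₁^q, …, x_N^q) A (x₁, …, x_N)ᵀ = ∑ i, x_i ^ q L_i`, where the coefficients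
of the linear form `L_i` are the entries of the `i`-th row of `A`. -/
noncomputable def matrixForm (q : ℕ) (A : Matrix (Fin N) (Fin N) k) : MvPolynomial (Fin N) k :=
  ∑ i, X i ^ q * ∑ j, C (A i j) * X j

/-- The matrix `A` represents the form `h`. -/
def Represents (q : ℕ) (A : Matrix (Fin N) (Fin N) k) (h : MvPolynomial (Fin N) k) : Prop :=
  h = matrixForm q A

/-- The matrix whose `(i, j)` entry is the coefficient of `x_i ^ q x_j` in `h`. By
`represents_iff` below, for `q ≥ 2` it is the unique matrix representing a Frobenius form `h`. -/
noncomputable def formMatrix (q : ℕ) (h : MvPolynomial (Fin N) k) : Matrix (Fin N) (Fin N) k :=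
  Matrix.of fun i j => coeff (Finsupp.single i q + Finsupp.single j 1) h

/-- The rank of a Frobenius form: the rank of its representing matrix. -/
noncomputable def rank (q : ℕ) (h : MvPolynomial (Fin N) k) : ℕ :=
  (formMatrix q h).rank

/-- The form obtained from `h` by the linear change of coordinates `x_i ↦ ∑ j, g i j x_j`. -/
noncomputable def changeCoords (g : GL (Fin N) k) (h : MvPolynomial (Fin N) k) :
    MvPolynomial (Fin N) k :=
  aeval (fun i => ∑ j, C (g.1 i j) * X j) h

/-- The embedding dimension of a form: the least number of variables occurring in it after a
linear change of coordinates. It is `N` exactly if `h` is non-degenerate, that is, cannot be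
written as a polynomial in fewer than `N` variables after any linear change of coordinates. -/
noncomputable def embDim (h : MvPolynomial (Fin N) k) : ℕ :=
  ⨅ g : GL (Fin N) k, (changeCoords g h).vars.card

/-- The sparse matrices for given `n` and `r`. Indices start at `0`, so the rows beyond the `r`-th
are those with index at least `r`. The last condition says that `A` has the entry `1` in the `r`
positions `(s, c s)`, where `c 0 > c 1 > ⋯ > c (r - 1)`, and the entry `0` everywhere else. (As
`c` is injective, `r ≤ N`, so that every `s < r` is the index of a row.) -/
def IsSparse (n r : ℕ) (A : Matrix (Fin N) (Fin N) k) : Prop :=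
  (∀ i j : Fin N, r ≤ (i : ℕ) → A i j = 0) ∧
  (∀ i j : Fin N, n ≤ (j : ℕ) → A i j = 0) ∧
  ∃ c : Fin r → Fin N, StrictAnti c ∧
    ∀ i j : Fin N, A i j = if ∃ s : Fin r, (s : ℕ) = (i : ℕ) ∧ c s = j then 1 else 0

theorem single_add_single_inj {q : ℕ} (hq : 2 ≤ q) {i j i' j' : Fin N}
    (h : (Finsupp.single i q + Finsupp.single j 1 : Fin N →₀ ℕ) =
      Finsupp.single i' q + Finsupp.single j' 1) : i = i' ∧ j = j' := by
  have hi : i = i' := by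
    by_contra hne
    have := DFunLike.congr_fun h i
    simp only [Finsupp.add_apply, Finsupp.single_eq_same, Finsupp.single_apply] at this
    split_ifs at this <;> omega
  subst hi
  exact ⟨rfl, (Finsupp.single_left_inj one_ne_zero).1 (add_left_cancel h)⟩

theorem matrixForm_eq (q : ℕ) (A : Matrix (Fin N) (Fin N) k) :
    matrixForm q A =
      ∑ i, ∑ j, monomial (Finsupp.single i q + Finsupp.single j 1) (A i j) := by
  simp only [matrixForm, Finset.mul_sum]
  refine Finset.sum_congr rfl fun i _ => Finset.sum_congr rfl fun j _ => ?_
  rw [X_pow_eq_monomial, X, C_mul_monomial, monomial_mul]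
  simp

theorem coeff_matrixForm {q : ℕ} (hq : 2 ≤ q) (A : Matrix (Fin N) (Fin N) k) (i j : Fin N) :
    coeff (Finsupp.single i q + Finsupp.single j 1) (matrixForm q A) = A i j := by
  classical
  simp only [matrixForm_eq, coeff_sum, coeff_monomial]
  rw [Finset.sum_eq_single i, Finset.sum_eq_single j]
  · simp
  · intro b _ hb
    exact if_neg fun h => hb (single_add_single_inj hq h).2
  · simp
  · intro b _ hb
    exact Finset.sum_eq_zero fun c _ => if_neg fun h => hb (single_add_single_inj hq h).1
  · simp

/-- For `q ≥ 2`, a Frobenius form is represented by exactly one matrix. -/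
theorem represents_iff {q : ℕ} (hq : 2 ≤ q) {h : MvPolynomial (Fin N) k}
    (hh : IsFrobeniusForm q h) (A : Matrix (Fin N) (Fin N) k) :
    Represents q A h ↔ A = formMatrix q h := by
  classical
  constructor
  · rintro rfl
    ext i j
    exact (coeff_matrixForm hq A i j).symm
  · rintro rfl
    have key : ∀ m, coeff m h ≠ 0 →
        ∃ i j : Fin N, m = Finsupp.single i q + Finsupp.single j 1 := by
      intro m hm
      have hmem := hh.2
      have hset : (Set.range fun i : Fin N => (X i : MvPolynomial (Fin N) k) ^ q) =
          (fun s => monomial s (1 : k)) '' Set.range fun i : Fin N => Finsupp.single i q := by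
        rw [← Set.range_comp]
        congr 1
        ext1 i
        simp [X_pow_eq_monomial]
      rw [hset, mem_ideal_span_monomial_image] at hmem
      obtain ⟨_, ⟨i, rfl⟩, hle⟩ := hmem m (mem_support_iff.2 hm)
      obtain ⟨t, rfl⟩ := exists_add_of_le hle
      have hd : (Finsupp.single i q + t).degree = q + 1 := by
        rw [Finsupp.degree_eq_weight_one]
        exact hh.1 hm
      rw [map_add, Finsupp.degree_single] at hd
      have ht : t.degree = 1 := by omega
      obtain ⟨j, rfl⟩ := (Finsupp.sum_eq_one_iff t).1 ht
      exact ⟨i, j, rfl⟩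
    refine MvPolynomial.ext _ _ fun m => ?_
    by_cases hm : ∃ i j : Fin N, m = Finsupp.single i q + Finsupp.single j 1
    · obtain ⟨i, j, rfl⟩ := hm
      rw [coeff_matrixForm hq]
      rfl
    · have h0 : coeff m h = 0 := by
        by_contra hc
        exact hm (key m hc)
      rw [h0, matrixForm_eq]
      simp only [coeff_sum, coeff_monomial]
      refine (Finset.sum_eq_zero fun i _ => Finset.sum_eq_zero fun j _ => if_neg fun he => ?_).symm
      exact hm ⟨i, j, he.symm⟩

end FrobeniusForms

/-!
A Frobenius form with matrix `A` is the form `x ↦ b x x` of the sesquilinear form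
`b u v = ∑ i j, σ (u i) * A i j * v j`, where `σ` is the `q`-th power map, and a change of
coordinates `g` replaces `A` by the Gram matrix `(g.map σ)ᵀ * A * g` of `b` on the columns of `g`
(`changeCoords_matrixForm`). So the claim is that `b` has a basis with sparse Gram matrix. A change
of coordinates that attains the embedding dimension `n` makes `A` vanish outside `n` rows and
columns; it is enough to treat the span `W` of the corresponding basis vectors, as the others lie in
both radicals of `b` (`exists_isSparse`).

If `b` is left nondegenerate on `W`, there is an antidiagonal Gram matrix (`exists_antidiagonal`).
By the argument of Lang and Dieudonné, the semilinear map `φ` with `b u (φ v) = σ (b v u)` has a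
non-zero fixed vector (`exists_fixed_vector`): in the basis of iterates of a cyclic vector, the
equation `φ x = x` becomes one polynomial equation for the last coordinate. The form is Hermitian on
fixed vectors, so two fixed vectors yield an isotropic one, `y`
(`exists_isotropic_hermitian_vector`). Take `x` isotropic with `b x y = 1`, and an antidiagonal
basis of a complement of the hyperbolic plane of `x` and `y`. The remaining unwanted entries
`b (e j) x` are removed by adding to `x` a combination of the `e j`, at the cost of equations of the form
`t ^ (q * q) - t = c`.

If `b` has a left radical (`exists_sparse`), choose the last basis vector `y` in it. If `y` also
lies in the right radical, split it off. Otherwise choose `x` isotropic with `b x y = 1`, and pass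
to a complement `W₀` of the plane of `x` and `y` with a sparse basis `e`. As `b y` vanishes on `W`,
adding multiples of `y` to `x` and to the `e j` repairs the row of `x`, whatever is added to `x`
from `W₀`; so all entries `b (e i) x` can be removed except those for which the row of `e i` in `W₀`
is zero, that is, `e i` lies in the left radical of `W₀`. The left radical of `W` meets `W₀` in a
subspace of codimension at most one in the left radical of `W₀`. If the basis of the latter is
adapted to this subspace, only one entry remains, in the first zero row, where a sparse matrix may
have it. To have adapted bases throughout the induction, `exists_sparse` is stated relative to a
chain of subspaces of the left radical.
-/

namespace FrobeniusForms

/-! ### Fixed vectors of Frobenius-semilinear maps -/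

open Polynomial in
theorem exists_eval_eq_self {k : Type*} [Field k] [IsAlgClosed k] {Q : ℕ} (hQ : 2 ≤ Q) (f : k[X])
    (hf : f ≠ 0) (hX : X ^ Q ∣ f) : ∃ t : k, t ≠ 0 ∧ f.eval t = t := by
  -- After division by `X`, the equation reads `X ^ (Q - 1) * s = 1`.
  obtain ⟨s, rfl⟩ := hX
  have hs : s ≠ 0 := right_ne_zero_of_mul hf
  have h1 : (X ^ (Q - 1) * s : k[X]).natDegree = Q - 1 + s.natDegree := by
    rw [natDegree_mul (pow_ne_zero _ X_ne_zero) hs, natDegree_X_pow]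
  have h2 : (X ^ (Q - 1) * s - C 1 : k[X]).degree ≠ 0 := by
    intro h0
    have := natDegree_eq_zero_iff_degree_le_zero.2 h0.le
    rw [natDegree_sub_C, h1] at this
    omega
  obtain ⟨t, ht⟩ := IsAlgClosed.exists_root _ h2
  simp only [IsRoot, eval_sub, eval_mul, eval_pow, eval_X, eval_C] at ht
  have h3 : t ^ (Q - 1) * s.eval t = 1 := by linear_combination ht
  refine ⟨t, ?_, ?_⟩
  · rintro rfl
    rw [zero_pow (by omega), zero_mul] at h3
    exact zero_ne_one h3
  · obtain ⟨Q', rfl⟩ : ∃ Q', Q = Q' + 1 := ⟨Q - 1, by omega⟩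
    simp only [eval_mul, eval_pow, eval_X]
    simp only [Nat.add_sub_cancel] at h3
    linear_combination t * h3

open Polynomial in
/-- The coordinates `c i` of a fixed vector `∑ c i • φ^i v`, as polynomials in the last one, where
the `a i` are the coefficients of a relation `φ^m v = ∑ a i • φ^i v`. -/
noncomputable def fixedCoord {k : Type*} [Field k] (Q : ℕ) (a : ℕ → k) : ℕ → k[X]
  | 0 => C (a 0) * X ^ Q
  | i + 1 => fixedCoord Q a i ^ Q + C (a (i + 1)) * X ^ Q

open Polynomial in
theorem X_pow_dvd_fixedCoord {k : Type*} [Field k] {Q : ℕ} (hQ : 2 ≤ Q) (a : ℕ → k) (i : ℕ) :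
    X ^ Q ∣ fixedCoord Q a i := by
  induction i with
  | zero => exact Dvd.intro_left _ rfl
  | succ i ih =>
    exact dvd_add (ih.trans (dvd_pow_self _ (by omega))) (Dvd.intro_left _ rfl)

open Polynomial in
theorem fixedCoord_ne_zero {k : Type*} [Field k] {Q : ℕ} (hQ : 2 ≤ Q) (a : ℕ → k) (i : ℕ)
    (h : ∃ j ≤ i, a j ≠ 0) : fixedCoord Q a i ≠ 0 := by
  induction i with
  | zero =>
    obtain ⟨j, hj, hj0⟩ := h
    obtain rfl : j = 0 := by omega
    simpa [fixedCoord] using hj0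
  | succ i ih =>
    by_cases h' : ∃ j ≤ i, a j ≠ 0
    · intro h0
      have h1 : fixedCoord Q a i ^ Q = C (-a (i + 1)) * X ^ Q := by
        simp only [fixedCoord] at h0
        rw [C_neg]
        linear_combination h0
      have h2 := congrArg natDegree h1
      rw [natDegree_pow] at h2
      have h3 := natDegree_C_mul_X_pow_le (-a (i + 1)) Q
      have h4 := natDegree_le_of_dvd (X_pow_dvd_fixedCoord hQ a i) (ih h')
      rw [natDegree_X_pow] at h4
      nlinarith
    · obtain ⟨j, hj, hj0⟩ := h
      have hji : j = i + 1 := by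
        by_contra hne
        exact h' ⟨j, by omega, hj0⟩
      subst hji
      push Not at h'
      have hz : ∀ l ≤ i, fixedCoord Q a l = 0 := by
        intro l hl
        induction l with
        | zero => simp [fixedCoord, h' 0 hl]
        | succ l ihl =>
          simp [fixedCoord, h' _ hl, ihl (by omega), show Q ≠ 0 by omega]
      simpa [fixedCoord, hz i le_rfl, show Q ≠ 0 by omega] using hj0

/-- An injective `τ`-semilinear endomorphism, where `τ` is the `Q`-th power map, has a non-zero
fixed vector. -/
theorem exists_fixed_vector {k M : Type*} [Field k] [IsAlgClosed k] [AddCommGroup M] [Module k M]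
    [FiniteDimensional k M] [Nontrivial M] {Q : ℕ} (hQ : 2 ≤ Q) {τ : k →+* k}
    (hτ : ∀ x, τ x = x ^ Q) (φ : M →ₛₗ[τ] M) (hφ : ∀ x, φ x = 0 → x = 0) :
    ∃ x, x ≠ 0 ∧ φ x = x := by
  classical
  obtain ⟨v, hv⟩ := exists_ne (0 : M)
  set u : ℕ → M := fun i => φ^[i] v with hu
  have hu0 : ∀ i, u i ≠ 0 := by
    intro i
    induction i with
    | zero => exact hv
    | succ i ih =>
      intro h0
      simp only [hu, Function.iterate_succ_apply'] at h0
      exact ih (hφ _ h0)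
  have hus : ∀ i, φ (u i) = u (i + 1) := fun i => (Function.iterate_succ_apply' φ i v).symm
  have hex : ∃ m, u m ∈ Submodule.span k (u '' (Finset.range m : Set ℕ)) := by
    let F : ℕ →o Submodule k M := ⟨fun m => Submodule.span k (u '' (Finset.range m : Set ℕ)),
      fun a b hab => Submodule.span_mono (Set.image_mono (by
        simpa using hab))⟩
    obtain ⟨m, hm⟩ := monotone_stabilizes_iff_noetherian.2 (inferInstance : IsNoetherian k M) F
    refine ⟨m, ?_⟩
    have h1 : u m ∈ F (m + 1) := Submodule.subset_span ⟨m, by simp, rfl⟩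
    rw [← hm (m + 1) (by omega)] at h1
    exact h1
  -- With `m` minimal, a combination of the `u l` for `l < m` is non-zero as soon as its last
  -- coefficient is.
  obtain ⟨m, hm, hmin⟩ : ∃ m, u m ∈ Submodule.span k (u '' (Finset.range m : Set ℕ)) ∧
      ∀ l < m, u l ∉ Submodule.span k (u '' (Finset.range l : Set ℕ)) :=
    ⟨Nat.find hex, Nat.find_spec hex, fun l hl => Nat.find_min hex hl⟩
  obtain _ | m := m
  · simp at hm
    exact absurd hm (hu0 0)
  obtain ⟨a, ha⟩ : ∃ a : ℕ → k, ∑ i ∈ Finset.range (m + 1), a i • u i = u (m + 1) := by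
    obtain ⟨a, ha⟩ := (Submodule.mem_span_image_finset_iff_exists_fun k).1 hm
    refine ⟨fun i => if h : i ∈ Finset.range (m + 1) then a ⟨i, h⟩ else 0, ?_⟩
    rw [← ha, ← Finset.sum_coe_sort]
    exact Finset.sum_congr rfl fun i _ => by simp
  have hane : ∃ j ≤ m, a j ≠ 0 := by
    by_contra hcon
    push Not at hcon
    apply hu0 (m + 1)
    rw [← ha]
    exact Finset.sum_eq_zero fun i hi => by
      rw [hcon i (by simpa [Nat.lt_succ_iff] using hi), zero_smul]
  obtain ⟨t, ht0, ht⟩ := exists_eval_eq_self hQ _ (fixedCoord_ne_zero hQ a m hane)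
    (X_pow_dvd_fixedCoord hQ a m)
  refine ⟨∑ i ∈ Finset.range (m + 1), (fixedCoord Q a i).eval t • u i, ?_, ?_⟩
  · intro h0
    rw [Finset.sum_range_succ, ht] at h0
    refine hmin m (by omega) ?_
    have h1 : u m = -t⁻¹ • ∑ i ∈ Finset.range m, (fixedCoord Q a i).eval t • u i := by
      rw [eq_neg_of_add_eq_zero_left h0, smul_neg, neg_smul, neg_neg, smul_smul,
        inv_mul_cancel₀ ht0, one_smul]
    rw [h1]
    exact Submodule.smul_mem _ _ (Submodule.sum_mem _ fun i hi =>
      Submodule.smul_mem _ _ (Submodule.subset_span ⟨i, hi, rfl⟩))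
  · rw [map_sum]
    simp only [map_smulₛₗ, hus, hτ]
    rw [Finset.sum_range_succ, ht, ← ha, Finset.smul_sum, Finset.sum_range_succ' _ m,
      Finset.sum_range_succ' _ m]
    simp only [fixedCoord, Polynomial.eval_add, Polynomial.eval_mul, Polynomial.eval_pow,
      Polynomial.eval_X, Polynomial.eval_C, add_smul, Finset.sum_add_distrib, smul_smul]
    simp only [mul_comm (t ^ Q), add_assoc]

/-! ### Sesquilinear forms and the nondegenerate case -/

section Sesquilinear

variable {k V : Type*} [Field k] [AddCommGroup V] [Module k V] {σ : k →+* k}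

/-- The left radical of the restriction of the sesquilinear form `b` to the subspace `W`, as a
subspace of the ambient space. -/
def leftRadical (b : V →ₛₗ[σ] V →ₗ[k] k) (W : Submodule k V) : Submodule k V where
  carrier := {w | w ∈ W ∧ ∀ x ∈ W, b w x = 0}
  add_mem' := fun {u v} hu hv => ⟨W.add_mem hu.1 hv.1, fun x hx => by simp [hu.2 x hx, hv.2 x hx]⟩
  zero_mem' := ⟨W.zero_mem, fun x _ => by simp⟩
  smul_mem' := fun c u hu => ⟨W.smul_mem c hu.1, fun x hx => by simp [hu.2 x hx]⟩

/-- The vectors `w` of `W` with `b w y = 0` and `b x w = 0`. If `σ` is surjective, `b x y = 1`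
and `b x x = b y y = 0`, this is a complement in `W` to the plane spanned by `x, y ∈ W`. -/
def perpPair (b : V →ₛₗ[σ] V →ₗ[k] k) (W : Submodule k V) (x y : V) : Submodule k V :=
  W ⊓ LinearMap.ker (b x) ⊓ LinearMap.ker (b.flip y)

theorem mem_perpPair {b : V →ₛₗ[σ] V →ₗ[k] k} {W : Submodule k V} {x y w : V} :
    w ∈ perpPair b W x y ↔ w ∈ W ∧ b x w = 0 ∧ b w y = 0 := by
  simp [perpPair, and_assoc]

theorem perpPair_le (b : V →ₛₗ[σ] V →ₗ[k] k) (W : Submodule k V) (x y : V) :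
    perpPair b W x y ≤ W := fun _ hw => (mem_perpPair.1 hw).1

theorem finrank_perpPair [FiniteDimensional k V] {b : V →ₛₗ[σ] V →ₗ[k] k} {W : Submodule k V}
    {x y : V} (hx : x ∈ W) (hy : y ∈ W) (hxx : b x x = 0) (hxy : b x y = 1) :
    Module.finrank k (perpPair b W x y) + 2 ≤ Module.finrank k W := by
  have h1 : perpPair b W x y < W ⊓ LinearMap.ker (b x) := by
    refine lt_of_le_of_ne inf_le_left fun h => ?_
    have : x ∈ perpPair b W x y := h ▸ ⟨hx, hxx⟩
    exact one_ne_zero (hxy ▸ (mem_perpPair.1 this).2.2)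
  have h2 : W ⊓ LinearMap.ker (b x) < W := by
    refine lt_of_le_of_ne inf_le_left fun h => ?_
    have : y ∈ W ⊓ LinearMap.ker (b x) := h.symm ▸ hy
    have h0 : b x y = 0 := this.2
    exact one_ne_zero (hxy.symm.trans h0)
  have := Submodule.finrank_lt_finrank_of_lt h1
  have := Submodule.finrank_lt_finrank_of_lt h2
  omega

theorem sub_sub_mem_perpPair {b : V →ₛₗ[σ] V →ₗ[k] k} {W : Submodule k V} {x y w : V} {α : k}
    (hx : x ∈ W) (hy : y ∈ W) (hxx : b x x = 0) (hxy : b x y = 1) (hyy : b y y = 0)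
    (hw : w ∈ W) (hα : σ α = b w y) : w - α • x - b x w • y ∈ perpPair b W x y := by
  refine mem_perpPair.2 ⟨?_, ?_, ?_⟩
  · exact W.sub_mem (W.sub_mem hw (W.smul_mem _ hx)) (W.smul_mem _ hy)
  · simp [hxx, hxy]
  · simp [hxy, hyy, hα]

/-- Replacing `x` by `a (x + w) + ν y`, each `e j` by `e j + μ j y` and `y` by `c y` preserves the
span of `x`, the `e j` and `y`. -/
theorem span_cons_snoc {W W₀ : Submodule k V} {x y w : V} {m : ℕ} {e : Fin m → V}
    (hx : x ∈ W) (hy : y ∈ W) (hW₀ : W₀ ≤ W) (he : Submodule.span k (Set.range e) = W₀)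
    (hw : w ∈ W₀) (hdec : ∀ v ∈ W, ∃ α β : k, v - α • x - β • y ∈ W₀)
    {a c : k} (ha : a ≠ 0) (hc : c ≠ 0) (ν : k) (μ : Fin m → k) :
    Submodule.span k (Set.range (Fin.cons (a • (x + w) + ν • y)
      (Fin.snoc (fun j => e j + μ j • y) (c • y) : Fin (m + 1) → V) : Fin (m + 2) → V)) = W := by
  set f : Fin (m + 2) → V := Fin.cons (a • (x + w) + ν • y)
      (Fin.snoc (fun j => e j + μ j • y) (c • y) : Fin (m + 1) → V) with hf
  set S := Submodule.span k (Set.range f) with hS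
  have heW : ∀ j, e j ∈ W₀ := fun j => he ▸ Submodule.subset_span ⟨j, rfl⟩
  apply le_antisymm
  · rw [hS, Submodule.span_le]
    rintro _ ⟨i, rfl⟩
    refine Fin.cases ?_ (fun i => Fin.lastCases ?_ (fun j => ?_) i) i
    · exact W.add_mem (W.smul_mem _ (W.add_mem hx (hW₀ hw))) (W.smul_mem _ hy)
    · simpa [hf] using W.smul_mem _ hy
    · simpa [hf] using W.add_mem (hW₀ (heW j)) (W.smul_mem (μ j) hy)
  · have hmem : ∀ i, f i ∈ S := fun i => Submodule.subset_span ⟨i, rfl⟩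
    have hyS : y ∈ S := by
      have h1 := S.smul_mem c⁻¹ (hmem (Fin.last m).succ)
      simpa [hf, smul_smul, inv_mul_cancel₀ hc] using h1
    have heS : ∀ j, e j ∈ S := by
      intro j
      have h1 := S.sub_mem (hmem j.castSucc.succ) (S.smul_mem (μ j) hyS)
      simpa [hf] using h1
    have hW₀S : W₀ ≤ S := by
      rw [← he, Submodule.span_le]
      rintro _ ⟨j, rfl⟩
      exact heS j
    have hxS : x ∈ S := by
      have h1 := S.smul_mem a⁻¹ (S.sub_mem (hmem 0) (S.smul_mem ν hyS))
      have h2 := S.sub_mem h1 (hW₀S hw)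
      simpa [hf, smul_smul, inv_mul_cancel₀ ha] using h2
    intro v hv
    obtain ⟨α, β, h⟩ := hdec v hv
    have := S.add_mem (S.add_mem (hW₀S h) (S.smul_mem β hyS)) (S.smul_mem α hxS)
    simpa using this

variable [IsAlgClosed k]

open Polynomial in
theorem exists_trinomial_root {Q : ℕ} (hQ : 2 ≤ Q) (a c : k) : ∃ t : k, t ^ Q + a * t + c = 0 := by
  have h1 : (C a * X + C c : k[X]).degree < (X ^ Q : k[X]).degree := by
    rw [degree_X_pow]
    exact degree_linear_le.trans_lt (by exact_mod_cast hQ)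
  have h2 : (X ^ Q + (C a * X + C c) : k[X]).degree ≠ 0 := by
    rw [degree_add_eq_left_of_degree_lt h1, degree_X_pow]
    exact_mod_cast (by omega : Q ≠ 0)
  obtain ⟨t, ht⟩ := IsAlgClosed.exists_root _ h2
  refine ⟨t, ?_⟩
  simpa [add_assoc] using ht

variable {q : ℕ} (hq : 2 ≤ q) (hσ : ∀ x, σ x = x ^ q)
include hq hσ

theorem surjective_of_eq_pow : Function.Surjective σ := fun y => by
  obtain ⟨x, hx⟩ := IsAlgClosed.exists_pow_nat_eq y (by omega : 0 < q)
  exact ⟨x, by rw [hσ, hx]⟩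

variable [FiniteDimensional k V] (b : V →ₛₗ[σ] V →ₗ[k] k)

open Matrix in
/-- On a left nondegenerate space, `b u (φ v) = σ (b v u)` defines an injective `σ ∘ σ`-semilinear
map `φ`, and a fixed vector of `φ` is a vector on which `b` is Hermitian. -/
theorem exists_hermitian_vector {W : Submodule k V} (hW : W ≠ ⊥) (hrad : leftRadical b W = ⊥) :
    ∃ v ∈ W, v ≠ 0 ∧ ∀ u ∈ W, b u v = σ (b v u) := by
  classical
  set n := Module.finrank k W
  let B := Module.finBasis k W
  let e : Fin n → V := fun i => B i
  have hspan : Submodule.span k (Set.range e) = W := by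
    have h1 : Set.range e = W.subtype '' Set.range B := by
      rw [← Set.range_comp]; rfl
    rw [h1, Submodule.span_image, B.span_eq, Submodule.map_top, Submodule.range_subtype]
  have hli : LinearIndependent k e :=
    B.linearIndependent.map' W.subtype (Submodule.ker_subtype W)
  let M : Matrix (Fin n) (Fin n) k := Matrix.of fun i j => b (e i) (e j)
  have hdet : M.det ≠ 0 := by
    intro h0
    obtain ⟨y, hy0, hy⟩ := Matrix.exists_vecMul_eq_zero_iff.2 h0
    choose z hz using fun i => surjective_of_eq_pow hq hσ (y i)
    have hw : ∑ i, z i • e i ∈ leftRadical b W := by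
      refine ⟨W.sum_mem fun i _ => W.smul_mem _ (B i).2, fun x hx => ?_⟩
      rw [← hspan] at hx
      induction hx using Submodule.span_induction with
      | mem x hx =>
        obtain ⟨j, rfl⟩ := hx
        have := congrFun hy j
        simpa [Matrix.vecMul, dotProduct, M, hz] using this
      | zero => simp
      | add u v _ _ hu hv => rw [map_add, hu, hv, add_zero]
      | smul c u _ hu => rw [map_smul, hu, smul_zero]
    rw [hrad, Submodule.mem_bot] at hw
    have hz0 := Fintype.linearIndependent_iff.1 hli z hw
    exact hy0 (funext fun i => by rw [← hz i, hz0 i, map_zero]; rfl)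
  have hunit : IsUnit M.det := isUnit_iff_ne_zero.2 hdet
  let φ : (Fin n → k) →ₛₗ[σ.comp σ] (Fin n → k) :=
    { toFun := fun x => M⁻¹ *ᵥ ((M.map σ)ᵀ *ᵥ fun i => σ (σ (x i)))
      map_add' := fun x y => by
        rw [← Matrix.mulVec_add, ← Matrix.mulVec_add]
        congr 2
        ext i
        simp
      map_smul' := fun c x => by
        rw [← Matrix.mulVec_smul, ← Matrix.mulVec_smul]
        congr 2
        ext i
        simp }
  have hMφ : ∀ x, M *ᵥ φ x = (M.map σ)ᵀ *ᵥ fun i => σ (σ (x i)) := fun x => by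
    change M *ᵥ (M⁻¹ *ᵥ _) = _
    rw [Matrix.mulVec_mulVec, Matrix.mul_nonsing_inv _ hunit, Matrix.one_mulVec]
  have hinj : ∀ x, φ x = 0 → x = 0 := by
    intro x hx
    have h1 := hMφ x
    rw [hx, Matrix.mulVec_zero] at h1
    by_contra hx0
    have h2 : ((M.map σ)ᵀ).det = 0 := Matrix.exists_mulVec_eq_zero_iff.1
      ⟨_, fun h => hx0 (funext fun i => by simpa using congrFun h i), h1.symm⟩
    rw [Matrix.det_transpose, ← RingHom.mapMatrix_apply, ← RingHom.map_det] at h2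
    exact hdet ((map_eq_zero σ).1 h2)
  have hpos : 0 < n := Nat.pos_of_ne_zero fun h => hW (Submodule.finrank_eq_zero.1 h)
  have : Nonempty (Fin n) := ⟨⟨0, hpos⟩⟩
  obtain ⟨x, hx0, hx⟩ := exists_fixed_vector (Q := q * q) (by nlinarith)
    (fun y => by rw [RingHom.comp_apply, hσ, hσ, pow_mul]) φ hinj
  refine ⟨∑ i, x i • e i, W.sum_mem fun i _ => W.smul_mem _ (B i).2, fun h0 => hx0 ?_, ?_⟩
  · exact funext (Fintype.linearIndependent_iff.1 hli x h0)
  · intro u hu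
    rw [← hspan] at hu
    induction hu using Submodule.span_induction with
    | mem u hu =>
      obtain ⟨i, rfl⟩ := hu
      have h1 := congrFun (hMφ x) i
      rw [hx] at h1
      simpa [Matrix.mulVec, dotProduct, M, mul_comm] using h1
    | zero => simp
    | add u v _ _ hu hv => rw [map_add, LinearMap.add_apply, hu, hv, map_add, map_add]
    | smul c u _ hu => rw [map_smulₛₗ, LinearMap.smul_apply, hu, map_smul, smul_eq_mul,
        smul_eq_mul, map_mul]

/-- In dimension at least two, the fixed vector can be taken isotropic: it is a
combination of two orthogonal fixed vectors. -/
theorem exists_isotropic_hermitian_vector {W : Submodule k V} (hW : 2 ≤ Module.finrank k W)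
    (hrad : leftRadical b W = ⊥) :
    ∃ v ∈ W, v ≠ 0 ∧ b v v = 0 ∧ ∀ u ∈ W, b u v = σ (b v u) := by
  obtain ⟨v, hvW, hv0, hv⟩ := exists_hermitian_vector hq hσ b (W := W)
    (fun h => by rw [h, finrank_bot] at hW; omega) hrad
  by_cases hvv : b v v = 0
  · exact ⟨v, hvW, hv0, hvv, hv⟩
  set W₁ := W ⊓ LinearMap.ker (b v) with hW₁
  have hdec : ∀ u ∈ W, ∃ c : k, u - c • v ∈ W₁ := by
    refine fun u hu => ⟨b v u / b v v, W.sub_mem hu (W.smul_mem _ hvW), ?_⟩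
    simp [div_mul_cancel₀ _ hvv]
  have hperp : ∀ u ∈ W₁, b u v = 0 := fun u hu => by
    rw [hv u hu.1, show b v u = 0 from hu.2, map_zero]
  have hW₁ne : W₁ ≠ ⊥ := by
    intro h0
    have h1 : W ≤ Submodule.span k {v} := fun u hu => by
      obtain ⟨c, hc⟩ := hdec u hu
      rw [h0, Submodule.mem_bot, sub_eq_zero] at hc
      exact Submodule.mem_span_singleton.2 ⟨c, hc.symm⟩
    have h2 := Submodule.finrank_mono h1
    rw [finrank_span_singleton hv0] at h2
    omega
  have hrad₁ : leftRadical b W₁ = ⊥ := by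
    rw [eq_bot_iff, ← hrad]
    rintro w ⟨hw, hw0⟩
    refine ⟨hw.1, fun x hx => ?_⟩
    obtain ⟨c, hc⟩ := hdec x hx
    have := hw0 _ hc
    rwa [map_sub, map_smul, hperp w hw, smul_zero, sub_zero] at this
  obtain ⟨w, hwW₁, hw0, hw₁⟩ := exists_hermitian_vector hq hσ b hW₁ne hrad₁
  have hvw : b v w = 0 := hwW₁.2
  have hwv : b w v = 0 := hperp w hwW₁
  have hw : ∀ u ∈ W, b u w = σ (b w u) := by
    intro u hu
    obtain ⟨c, hc⟩ := hdec u hu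
    have := hw₁ _ hc
    simpa [hvw, hwv] using this
  by_cases hww : b w w = 0
  · exact ⟨w, hwW₁.1, hw0, hww, hw⟩
  -- The equation `t ^ (q + 1) = - b v v / b w w` has its right-hand side fixed by `σ`, so that
  -- `t` is fixed by `σ ∘ σ`; hence `b` is Hermitian on `v + t w`.
  obtain ⟨t, ht⟩ := IsAlgClosed.exists_pow_nat_eq (-(b v v / b w w)) (by omega : 0 < q + 1)
  have htt : σ (t ^ (q + 1)) = t ^ (q + 1) := by
    rw [ht, map_neg, map_div₀, ← hv v hvW, ← hw w hwW₁.1]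
  have ht0 : t ≠ 0 := by
    rintro rfl
    rw [zero_pow (by omega), eq_comm, neg_eq_zero, div_eq_zero_iff] at ht
    exact ht.elim hvv hww
  have hσσ : σ (σ t) = t := by
    rw [pow_succ, map_mul, ← hσ] at htt
    have h1 : σ t ≠ 0 := (map_ne_zero σ).2 ht0
    apply mul_right_cancel₀ h1
    rw [htt, mul_comm]
  refine ⟨v + t • w, W.add_mem hvW (W.smul_mem _ hwW₁.1), ?_, ?_, ?_⟩
  · intro h0
    have h1 := congrArg (b v) h0
    simp [hvw, hvv] at h1
  · have h1 : t ^ (q + 1) * b w w = - b v v := by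
      rw [ht, neg_mul, div_mul_cancel₀ _ hww]
    simp only [map_add, LinearMap.add_apply, map_smulₛₗ, LinearMap.smul_apply, smul_eq_mul, hvw,
      hwv, hσ, RingHom.id_apply]
    rw [pow_succ] at h1
    linear_combination h1
  · intro u hu
    simp [hv u hu, hw u hu, hσσ]

/-- A left nondegenerate space has a basis in which the Gram matrix is the antidiagonal one. -/
theorem exists_antidiagonal (W : Submodule k V) (hrad : leftRadical b W = ⊥) :
    ∃ (m : ℕ) (e : Fin m → V), m ≤ Module.finrank k W ∧ Submodule.span k (Set.range e) = W ∧
      ∀ i j, b (e i) (e j) = if j = i.rev then 1 else 0 := by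
  classical
  induction hn : Module.finrank k W using Nat.strong_induction_on generalizing W with
  | _ n ih =>
  have hσs := surjective_of_eq_pow hq hσ
  obtain rfl | rfl | hn2 : n = 0 ∨ n = 1 ∨ 2 ≤ n := by omega
  · refine ⟨0, Fin.elim0, le_rfl, ?_, fun i => i.elim0⟩
    rw [Submodule.finrank_eq_zero.1 hn]
    simp
  · obtain ⟨v, hv0, hv⟩ := finrank_eq_one_iff'.1 hn
    have hspan : Submodule.span k {(v : V)} = W := by
      refine le_antisymm ((Submodule.span_singleton_le_iff_mem _ _).2 v.2) fun w hw => ?_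
      obtain ⟨c, hc⟩ := hv ⟨w, hw⟩
      exact Submodule.mem_span_singleton.2 ⟨c, congrArg Subtype.val hc⟩
    have hvv : b v v ≠ 0 := by
      intro h0
      have h1 : (v : V) ∈ leftRadical b W := by
        refine ⟨v.2, fun x hx => ?_⟩
        rw [← hspan] at hx
        obtain ⟨c, rfl⟩ := Submodule.mem_span_singleton.1 hx
        rw [map_smul, h0, smul_zero]
      rw [hrad, Submodule.mem_bot] at h1
      exact hv0 (Subtype.ext h1)
    obtain ⟨a, ha⟩ := IsAlgClosed.exists_pow_nat_eq (b v v)⁻¹ (by omega : 0 < q + 1)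
    have ha0 : a ≠ 0 := by
      rintro rfl
      rw [zero_pow (by omega)] at ha
      exact inv_ne_zero hvv ha.symm
    refine ⟨1, fun _ => a • (v : V), le_rfl, ?_, fun i j => ?_⟩
    · rw [Set.range_const, Submodule.span_singleton_smul_eq (isUnit_iff_ne_zero.2 ha0), hspan]
    · rw [if_pos (Subsingleton.elim _ _)]
      simp only [map_smulₛₗ, LinearMap.smul_apply, smul_eq_mul, RingHom.id_apply, hσ]
      rw [pow_succ] at ha
      linear_combination b v v * ha + inv_mul_cancel₀ hvv
  · obtain ⟨y, hyW, hy0, hyy, hy⟩ :=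
      exists_isotropic_hermitian_vector hq hσ b (hn ▸ hn2) hrad
    obtain ⟨x, hxW, hxx, hxy⟩ : ∃ x ∈ W, b x x = 0 ∧ b x y = 1 := by
      obtain ⟨u, huW, hu⟩ : ∃ u ∈ W, b y u ≠ 0 := by
        by_contra! hcon
        have h1 : y ∈ leftRadical b W := ⟨hyW, hcon⟩
        rw [hrad] at h1
        exact hy0 h1
      have huy : b u y ≠ 0 := by
        rw [hy u huW]
        exact (map_ne_zero σ).2 hu
      obtain ⟨c, hc⟩ := hσs (b u y)⁻¹
      have h1 : b (c • u) y = 1 := by simp [hc, huy]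
      have h2 : b y (c • u) = 1 := σ.injective (by rw [← hy _ (W.smul_mem c huW), h1, map_one])
      obtain ⟨ν, hν⟩ := exists_trinomial_root hq 1 (b (c • u) (c • u))
      refine ⟨c • u + ν • y, W.add_mem (W.smul_mem _ huW) (W.smul_mem _ hyW), ?_, ?_⟩
      · simp only [map_add (b _), map_add b, LinearMap.add_apply, map_smul (b _) ν,
          map_smulₛₗ b ν, LinearMap.smul_apply, h1, h2, hyy, smul_eq_mul, hσ]
        linear_combination hν
      · rw [map_add, LinearMap.add_apply, h1, map_smulₛₗ, LinearMap.smul_apply, hyy, smul_zero,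
          add_zero]
    have hyx : b y x = 1 := σ.injective (by rw [← hy _ hxW, hxy, map_one])
    set W₀ := perpPair b W x y with hW₀
    have hyW₀ : ∀ w ∈ W₀, b y w = 0 := fun w hw => σ.injective (by
      rw [← hy _ (mem_perpPair.1 hw).1, (mem_perpPair.1 hw).2.2, map_zero])
    have hdec : ∀ v ∈ W, ∃ α β : k, v - α • x - β • y ∈ W₀ := fun v hv => by
      obtain ⟨α, hα⟩ := hσs (b v y)
      exact ⟨α, b x v, sub_sub_mem_perpPair hxW hyW hxx hxy hyy hv hα⟩
    -- A vector of the left radical of `W₀` is a multiple of `y` up to the left radical of `W`.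
    have hrad₀ : leftRadical b W₀ = ⊥ := by
      rw [eq_bot_iff]
      rintro w ⟨hw, hw0⟩
      obtain ⟨hwW, hxw, hwy⟩ := mem_perpPair.1 hw
      obtain ⟨z, hz⟩ := hσs (b w x)
      have h1 : w - z • y ∈ leftRadical b W := by
        refine ⟨W.sub_mem hwW (W.smul_mem _ hyW), fun v hv => ?_⟩
        obtain ⟨α, β, h⟩ := hdec v hv
        have h2 := hw0 _ h
        have h3 := hyW₀ _ h
        simp only [map_sub, map_smul, hwy, hyx, hyy, smul_eq_mul, mul_zero, mul_one,
          sub_zero] at h2 h3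
        simp only [map_sub, map_smulₛₗ, LinearMap.sub_apply, LinearMap.smul_apply, smul_eq_mul, hz]
        linear_combination h2 - b w x * h3
      rw [hrad, Submodule.mem_bot, sub_eq_zero] at h1
      rw [h1, map_smul, hxy, smul_eq_mul, mul_one] at hxw
      rw [h1, hxw, zero_smul]
      exact Submodule.zero_mem _
    have hfr := finrank_perpPair hxW hyW hxx hxy
    rw [← hW₀, hn] at hfr
    obtain ⟨m, e, hm, hspan, hgram⟩ := ih _ (by omega) W₀ hrad₀ rfl
    have heW₀ : ∀ j, e j ∈ W₀ := fun j => hspan ▸ Submodule.subset_span ⟨j, rfl⟩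
    have hxe : ∀ j, b x (e j) = 0 := fun j => (mem_perpPair.1 (heW₀ j)).2.1
    have hey : ∀ j, b (e j) y = 0 := fun j => (mem_perpPair.1 (heW₀ j)).2.2
    have hye : ∀ j, b y (e j) = 0 := fun j => hyW₀ _ (heW₀ j)
    -- Since `b (e j) w = d j` and `b w (e j) = σ (d j)`, this choice of `w` gives
    -- `b (e j - b w (e j) • y) (x + w) = 0`.
    choose d hd using fun j => exists_trinomial_root (Q := q * q) (by nlinarith) (-1)
      (-b (e j) x)
    set w := ∑ i, d i.rev • e i with hw
    have hwW₀ : w ∈ W₀ := W₀.sum_mem fun i _ => W₀.smul_mem _ (heW₀ i)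
    have hew : ∀ j, b (e j) w = d j := fun j => by
      simp [hw, hgram]
    have hwe : ∀ j, b w (e j) = σ (d j) := fun j => by
      simp only [hw, map_sum, map_smulₛₗ, LinearMap.sum_apply, LinearMap.smul_apply, hgram]
      rw [Finset.sum_eq_single j.rev]
      · simp
      · intro i _ hi
        rw [if_neg (fun h => hi (by rw [h, Fin.rev_rev])), smul_zero]
      · simp
    have hxw : b x w = 0 := (mem_perpPair.1 hwW₀).2.1
    have hwy : b w y = 0 := (mem_perpPair.1 hwW₀).2.2
    have hyw : b y w = 0 := hyW₀ _ hwW₀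
    obtain ⟨ν, hν⟩ := exists_trinomial_root hq 1 (b (x + w) (x + w))
    refine ⟨m + 2, _, by omega, span_cons_snoc hxW hyW (perpPair_le b W x y) hspan hwW₀ hdec
      one_ne_zero one_ne_zero ν (fun j => -σ (d j)), fun i j => ?_⟩
    simp only [one_smul]
    have hdσ : ∀ j, b (e j) x + d j - σ (σ (d j)) = 0 := fun j => by
      rw [hσ, hσ, ← pow_mul]
      linear_combination -hd j
    rw [← hσ] at hν
    induction i using Fin.cases with
    | zero =>
      induction j using Fin.cases with
      | zero =>
        simp [hyx, hxy, hyy, hwy, hyw, hxx, hxw] at hν ⊢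
        linear_combination hν
      | succ j =>
        induction j using Fin.lastCases with
        | last => simp [hxy, hyy, hwy]
        | cast j =>
          simp [hxy, hyy, hwy, hxe, hwe, hye, Fin.ext_iff]
          omega
    | succ i =>
      induction i using Fin.lastCases with
      | last =>
        induction j using Fin.cases with
        | zero => simp [hyx, hyy, hyw]
        | succ j =>
          induction j using Fin.lastCases with
          | last => simp [hyy, Fin.ext_iff]
          | cast j => simp [hyy, hye, Fin.ext_iff]
      | cast i =>
        induction j using Fin.cases with
        | zero =>
          simp [hyx, hyy, hyw, hew, hey, Fin.ext_iff, Fin.rev_succ, Fin.rev_castSucc]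
          linear_combination hdσ i
        | succ j =>
          induction j using Fin.lastCases with
          | last =>
            simp [hyy, hey, Fin.rev_succ, Fin.rev_castSucc]
            rw [← Fin.succ_last, Fin.succ_inj]
            exact (Fin.castSucc_ne_last _).symm
          | cast j => simp [hyy, hey, hye, hgram, Fin.rev_succ, Fin.rev_castSucc]

end Sesquilinear

/-! ### Decreasing relations -/

/-- The pattern of the non-zero entries of a sparse matrix: a strictly decreasing partial map,
given by its graph `R`, whose domain is an initial segment. -/
def IsDecreasing {m : ℕ} (R : Fin m → Fin m → Prop) : Prop :=
  (∀ i j i' j', R i j → R i' j' → (i < i' ↔ j' < j)) ∧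
    ∀ i i' j', R i' j' → i < i' → ∃ j, R i j

namespace IsDecreasing

variable {m : ℕ} {R : Fin m → Fin m → Prop} (hR : IsDecreasing R)
include hR

theorem right_unique {i j j' : Fin m} (h : R i j) (h' : R i j') : j = j' := by
  have h1 := hR.1 _ _ _ _ h h'
  have h2 := hR.1 _ _ _ _ h' h
  simp only [lt_irrefl, false_iff, not_lt] at h1 h2
  exact le_antisymm h1 h2

theorem left_unique {i i' j : Fin m} (h : R i j) (h' : R i' j) : i = i' := by
  have h1 := hR.1 _ _ _ _ h h'
  have h2 := hR.1 _ _ _ _ h' h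
  simp only [lt_irrefl, iff_false, not_lt] at h1 h2
  exact le_antisymm h2 h1

theorem exists_of_le {i i' : Fin m} (h : i ≤ i') (h' : ∃ j, R i' j) : ∃ j, R i j := by
  obtain rfl | hlt := h.eq_or_lt
  · exact h'
  · obtain ⟨j', hj'⟩ := h'
    exact hR.2 _ _ _ hj' hlt

end IsDecreasing

theorem isDecreasing_rev (m : ℕ) : IsDecreasing fun i j : Fin m => j = i.rev :=
  ⟨by rintro i _ i' _ rfl rfl; exact Fin.rev_lt_rev.symm, fun i _ _ _ _ => ⟨i.rev, rfl⟩⟩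

/-- The relation `R`, with an index added at the end that is related to nothing. -/
def snocRel {m : ℕ} (R : Fin m → Fin m → Prop) (x y : Fin (m + 1)) : Prop :=
  ∃ i j, x = i.castSucc ∧ y = j.castSucc ∧ R i j

theorem IsDecreasing.snocRel {m : ℕ} {R : Fin m → Fin m → Prop} (hR : IsDecreasing R) :
    IsDecreasing (snocRel R) := by
  constructor
  · rintro _ _ _ _ ⟨i, j, rfl, rfl, h⟩ ⟨i', j', rfl, rfl, h'⟩
    simpa using hR.1 _ _ _ _ h h'
  · rintro x _ _ ⟨i', j', rfl, rfl, h'⟩ hx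
    induction x using Fin.lastCases with
    | last => exact absurd hx (not_lt.2 (Fin.le_last _))
    | cast i =>
      obtain ⟨j, hj⟩ := hR.2 i i' j' h' (by simpa using hx)
      exact ⟨j.castSucc, i, j, rfl, rfl, hj⟩

/-- The relation `R`, with a first index added that is related to a new last one, and with the
elements of `T` related to the first index. -/
def consSnocRel {m : ℕ} (R : Fin m → Fin m → Prop) (T : Fin m → Prop)
    (x y : Fin (m + 2)) : Prop :=
  (x = 0 ∧ y = Fin.last (m + 1)) ∨
    (∃ i j, x = i.castSucc.succ ∧ y = j.castSucc.succ ∧ R i j) ∨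
    ∃ i, x = i.castSucc.succ ∧ y = 0 ∧ T i

section
variable {m : ℕ} (R : Fin m → Fin m → Prop) (T : Fin m → Prop)

theorem consSnocRel_zero_zero : ¬ consSnocRel R T 0 0 := by
  simp [consSnocRel, Fin.ext_iff]

theorem consSnocRel_zero_last : consSnocRel R T 0 (Fin.last m).succ := Or.inl ⟨rfl, rfl⟩

theorem consSnocRel_zero_succ (j : Fin m) : ¬ consSnocRel R T 0 j.castSucc.succ := by
  have := j.2
  simp [consSnocRel, Fin.ext_iff]
  omega

theorem consSnocRel_last (y : Fin (m + 2)) : ¬ consSnocRel R T (Fin.last m).succ y := by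
  rintro (⟨h, -⟩ | ⟨i, j, h, -, -⟩ | ⟨i, h, -, -⟩)
  · exact Fin.succ_ne_zero _ h
  · exact Fin.castSucc_ne_last i (Fin.succ_injective _ h).symm
  · exact Fin.castSucc_ne_last i (Fin.succ_injective _ h).symm

theorem consSnocRel_succ_zero (i : Fin m) : consSnocRel R T i.castSucc.succ 0 ↔ T i := by
  constructor
  · rintro (⟨h, -⟩ | ⟨i', j, -, h, -⟩ | ⟨i', h, -, hi'⟩)
    · exact absurd h (Fin.succ_ne_zero _)
    · exact absurd h.symm (Fin.succ_ne_zero _)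
    · rwa [Fin.castSucc_injective _ (Fin.succ_injective _ h)]
  · exact fun h => Or.inr (Or.inr ⟨i, rfl, rfl, h⟩)

theorem consSnocRel_succ_last (i : Fin m) :
    ¬ consSnocRel R T i.castSucc.succ (Fin.last m).succ := by
  rintro (⟨h, -⟩ | ⟨i, j, -, h, -⟩ | ⟨i, -, h, -⟩)
  · exact Fin.succ_ne_zero _ h
  · exact Fin.castSucc_ne_last j (Fin.succ_injective _ h).symm
  · exact Fin.succ_ne_zero _ h

theorem consSnocRel_succ_succ (i j : Fin m) :
    consSnocRel R T i.castSucc.succ j.castSucc.succ ↔ R i j := by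
  simp [consSnocRel]

end

theorem IsDecreasing.consSnocRel {m : ℕ} {R : Fin m → Fin m → Prop} (hR : IsDecreasing R)
    {T : Fin m → Prop} (hT : ∀ i, T i → ∀ i', i' < i ↔ ∃ j, R i' j) :
    IsDecreasing (consSnocRel R T) := by
  have hlast : ∀ j : Fin m, j.castSucc.succ < Fin.last (m + 1) := fun j => by
    rw [← Fin.succ_last, Fin.succ_lt_succ_iff]
    exact Fin.castSucc_lt_last j
  constructor
  · rintro _ _ _ _ (⟨rfl, rfl⟩ | ⟨i, j, rfl, rfl, h⟩ | ⟨i, rfl, rfl, h⟩)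
      (⟨rfl, rfl⟩ | ⟨i', j', rfl, rfl, h'⟩ | ⟨i', rfl, rfl, h'⟩)
    · simp
    · simp [hlast]
    · simp [Fin.last_pos]
    · simpa using (hlast j).le
    · simpa using hR.1 _ _ _ _ h h'
    · simpa using (hT i' h' i).2 ⟨j, h⟩
    · simp
    · simpa using ((hT i h i').2 ⟨j', h'⟩).le
    · have : ¬ i < i' := fun hlt => lt_irrefl i ((hT i h i).2 ((hT i' h' i).1 hlt))
      simpa using this
  · rintro x _ _ (⟨rfl, rfl⟩ | ⟨i', j', rfl, rfl, h'⟩ | ⟨i', rfl, rfl, h'⟩) hx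
    · exact absurd hx (Fin.not_lt_zero x)
    all_goals
      induction x using Fin.cases with
      | zero => exact ⟨_, Or.inl ⟨rfl, rfl⟩⟩
      | succ x =>
        induction x using Fin.lastCases with
        | last => exact absurd ((hlast _).trans hx) (lt_irrefl _)
        | cast i =>
          have hlt : i < i' := by simpa using hx
          obtain ⟨j, hj⟩ : ∃ j, R i j := by
            first
              | exact hR.2 i i' j' h' hlt
              | exact (hT i' h' i).1 hlt
          exact ⟨j.castSucc.succ, Or.inr (Or.inl ⟨i, j, rfl, rfl, hj⟩)⟩

theorem isChain_image_inf {α : Type*} [SemilatticeInf α] {C : Set α} (hC : IsChain (· ≤ ·) C)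
    (w : α) : IsChain (· ≤ ·) ((· ⊓ w) '' C) := by
  rintro _ ⟨u, hu, rfl⟩ _ ⟨v, hv, rfl⟩ -
  exact (hC.total hu hv).imp (inf_le_inf_right w) (inf_le_inf_right w)

/-- A decreasing relation is the graph of a strictly decreasing map on an initial segment. -/
theorem IsDecreasing.exists_strictAnti {m : ℕ} {R : Fin m → Fin m → Prop} (hR : IsDecreasing R) :
    ∃ (r : ℕ) (c : Fin r → Fin m), StrictAnti c ∧ r ≤ m ∧
      ∀ i j, R i j ↔ ∃ s : Fin r, (s : ℕ) = (i : ℕ) ∧ c s = j := by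
  classical
  have hex : ∃ r : ℕ, ∀ i : Fin m, (∃ j, R i j) → (i : ℕ) < r := ⟨m, fun i _ => i.2⟩
  obtain ⟨r, hr, hmin⟩ : ∃ r : ℕ, (∀ i : Fin m, (∃ j, R i j) → (i : ℕ) < r) ∧
      ∀ r' < r, ∃ i : Fin m, (∃ j, R i j) ∧ r' ≤ (i : ℕ) := by
    refine ⟨Nat.find hex, Nat.find_spec hex, fun r' hr' => ?_⟩
    have := Nat.find_min hex hr'
    push Not at this
    exact this
  have hdom : ∀ s : Fin r, ∃ (i : Fin m) (j : Fin m), (i : ℕ) = s ∧ R i j := by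
    intro s
    obtain ⟨i', hi', hle⟩ := hmin s s.2
    obtain ⟨j, hj⟩ := hR.exists_of_le (i := ⟨s, hle.trans_lt i'.2⟩) hle hi'
    exact ⟨_, j, rfl, hj⟩
  choose ι c hι hc using hdom
  refine ⟨r, c, fun s s' h => ?_, ?_, fun i j => ⟨fun h => ?_, ?_⟩⟩
  · refine (hR.1 _ _ _ _ (hc s) (hc s')).1 ?_
    rw [Fin.lt_def, hι, hι]
    exact h
  · by_contra! hlt
    obtain ⟨i, -, hle⟩ := hmin m hlt
    exact absurd i.2 (not_lt.2 hle)
  · refine ⟨⟨i, hr i ⟨j, h⟩⟩, rfl, ?_⟩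
    have h1 := hc ⟨i, hr i ⟨j, h⟩⟩
    rw [show ι ⟨i, hr i ⟨j, h⟩⟩ = i from Fin.ext (hι _)] at h1
    exact hR.right_unique h1 h
  · rintro ⟨s, hs, rfl⟩
    have h1 := hc s
    rwa [show ι s = i from Fin.ext ((hι s).trans hs)] at h1

/-! ### Sparse bases of sesquilinear forms -/

section Sesquilinear

variable {k V : Type*} [Field k] [AddCommGroup V] [Module k V] {σ : k →+* k} [IsAlgClosed k]
  {q : ℕ} (hq : 2 ≤ q) (hσ : ∀ x, σ x = x ^ q)
  [FiniteDimensional k V] (b : V →ₛₗ[σ] V →ₗ[k] k)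
include hq hσ

open Classical in
/-- A sesquilinear form has a basis with sparse Gram matrix, in which moreover each member of a
given chain `C` of subspaces of the left radical is spanned by a final segment of the basis. As `m`
is at most the dimension, the spanning family `e` is a basis. -/
theorem exists_sparse (W : Submodule k V) (C : Set (Submodule k V)) (hC : IsChain (· ≤ ·) C)
    (hCW : ∀ U ∈ C, U ≤ leftRadical b W) :
    ∃ (m : ℕ) (e : Fin m → V) (R : Fin m → Fin m → Prop), m ≤ Module.finrank k W ∧
      Submodule.span k (Set.range e) = W ∧ IsDecreasing R ∧
      (∀ i j, b (e i) (e j) = if R i j then 1 else 0) ∧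
      ∀ U ∈ C, ∃ S : Set (Fin m), IsUpperSet S ∧ Submodule.span k (e '' S) = U := by
  induction hn : Module.finrank k W using Nat.strong_induction_on generalizing W C with
  | _ n ih =>
  have hσs := surjective_of_eq_pow hq hσ
  by_cases hrad : leftRadical b W = ⊥
  · obtain ⟨m, e, hm, hspan, hgram⟩ := exists_antidiagonal hq hσ b W hrad
    refine ⟨m, e, _, hn ▸ hm, hspan, isDecreasing_rev m, fun i j => ?_,
      fun U hU => ⟨∅, isUpperSet_empty, ?_⟩⟩
    · convert hgram i j
    · have h1 := hCW U hU
      rw [hrad, le_bot_iff] at h1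
      rw [h1]
      simp
  -- `y` is taken in the least non-zero member of the chain, enlarged by the left radical.
  obtain ⟨y, hy0, hyr, hyC⟩ : ∃ y, y ≠ 0 ∧ y ∈ leftRadical b W ∧ ∀ U ∈ C, U ≠ ⊥ → y ∈ U := by
    have hne : {U | U ∈ insert (leftRadical b W) C ∧ U ≠ ⊥}.Nonempty :=
      ⟨leftRadical b W, Set.mem_insert _ _, hrad⟩
    obtain ⟨U₀, ⟨hU₀C, hU₀⟩, hmin⟩ := wellFounded_lt.has_min _ hne
    have hC' : IsChain (· ≤ ·) (insert (leftRadical b W) C) :=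
      hC.insert fun U hU _ => Or.inr (hCW U hU)
    obtain ⟨y, hy, hy0⟩ := Submodule.exists_mem_ne_zero_of_ne_bot hU₀
    have hle : ∀ U ∈ insert (leftRadical b W) C, U ≠ ⊥ → U₀ ≤ U := fun U hU hU0 =>
      (hC'.total hU₀C hU).elim id fun h =>
        (eq_of_le_of_not_lt h (hmin U ⟨hU, hU0⟩)).ge
    exact ⟨y, hy0, hle _ (Set.mem_insert _ _) hrad hy,
      fun U hU hU0 => hle U (Set.mem_insert_of_mem _ hU) hU0 hy⟩
  obtain ⟨hyW, hyv⟩ := hyr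
  by_cases hright : ∀ w ∈ W, b w y = 0
  · -- `y` lies in both radicals and spans a direct summand.
    obtain ⟨g, hg⟩ : ∃ g : V →ₗ[k] k, g y = 1 := by
      obtain ⟨g, -, hg⟩ := LinearMap.exists_extend_of_notMem (p := (⊥ : Submodule k V)) (v := y)
        (0 : _ →ₗ[k] k) (by simpa using hy0) 1
      exact ⟨g, hg⟩
    set W₀ := W ⊓ LinearMap.ker g with hW₀
    have hW₀W : W₀ ≤ W := inf_le_left
    have hdec : ∀ v ∈ W, v - g v • y ∈ W₀ := fun v hv =>
      ⟨W.sub_mem hv (W.smul_mem _ hyW), by simp [hg]⟩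
    have hlt : W₀ < W := by
      refine lt_of_le_of_ne hW₀W fun h => ?_
      have h1 : y ∈ W₀ := h.symm ▸ hyW
      have h2 : g y = 0 := h1.2
      exact one_ne_zero (hg.symm.trans h2)
    have hfr := Submodule.finrank_lt_finrank_of_lt hlt
    obtain ⟨m, e, R, hm, hspan, hR, hgram, hflag⟩ := ih _ (hn ▸ hfr) W₀ ((· ⊓ W₀) '' C)
      (isChain_image_inf hC W₀) (by
        rintro _ ⟨U, hU, rfl⟩ u ⟨huU, huW₀⟩
        exact ⟨huW₀, fun v hv => (hCW U hU huU).2 v (hW₀W hv)⟩) rfl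
    have heW₀ : ∀ j, e j ∈ W₀ := fun j => hspan ▸ Submodule.subset_span ⟨j, rfl⟩
    refine ⟨m + 1, Fin.snoc e y, snocRel R, by omega, ?_, hR.snocRel, fun i j => ?_,
      fun U hU => ?_⟩
    · apply le_antisymm
      · rw [Submodule.span_le]
        rintro _ ⟨i, rfl⟩
        induction i using Fin.lastCases with
        | last => simpa using hyW
        | cast i => simpa using hW₀W (heW₀ i)
      · intro v hv
        have hmem : ∀ i, (Fin.snoc e y : Fin (m + 1) → V) i ∈
            Submodule.span k (Set.range (Fin.snoc e y : Fin (m + 1) → V)) :=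
          fun i => Submodule.subset_span ⟨i, rfl⟩
        have h1 : W₀ ≤ Submodule.span k (Set.range (Fin.snoc e y : Fin (m + 1) → V)) := by
          rw [← hspan, Submodule.span_le]
          rintro _ ⟨i, rfl⟩
          simpa using hmem i.castSucc
        have h2 := hmem (Fin.last m)
        rw [Fin.snoc_last] at h2
        simpa using Submodule.add_mem _ (h1 (hdec v hv)) (Submodule.smul_mem _ (g v) h2)
    · induction i using Fin.lastCases with
      | last =>
        rw [if_neg (by rintro ⟨i, j, h, -, -⟩; exact Fin.castSucc_ne_last i h.symm)]
        induction j using Fin.lastCases with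
        | last => simpa using hyv y hyW
        | cast j => simpa using hyv _ (hW₀W (heW₀ j))
      | cast i =>
        induction j using Fin.lastCases with
        | last =>
          rw [if_neg (by rintro ⟨i, j, -, h, -⟩; exact Fin.castSucc_ne_last j h.symm)]
          simpa using hright _ (hW₀W (heW₀ i))
        | cast j => simp [hgram, snocRel]
    · by_cases hU0 : U = ⊥
      · exact ⟨∅, isUpperSet_empty, by simp [hU0]⟩
      have hyU := hyC U hU hU0
      obtain ⟨S, hSup, hS⟩ := hflag _ ⟨U, hU, rfl⟩
      change _ = U ⊓ W₀ at hS
      refine ⟨{i | i = Fin.last m ∨ ∃ s ∈ S, i = s.castSucc}, ?_, le_antisymm ?_ ?_⟩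
      · rintro i i' hii' hi
        induction i' using Fin.lastCases with
        | last => exact Or.inl rfl
        | cast i' =>
          obtain rfl | ⟨s, hs, rfl⟩ := hi
          · exact absurd (Fin.castSucc_lt_last i') (not_lt.2 hii')
          · exact Or.inr ⟨i', hSup (by simpa using hii') hs, rfl⟩
      · rw [Submodule.span_le]
        rintro _ ⟨_, rfl | ⟨s, hs, rfl⟩, rfl⟩
        · simpa using hyU
        · have h1 : e s ∈ U ⊓ W₀ := hS ▸ Submodule.subset_span ⟨s, hs, rfl⟩
          simpa using h1.1
      · intro u hu
        set S' := Submodule.span k ((Fin.snoc e y : Fin (m + 1) → V) ''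
          {i | i = Fin.last m ∨ ∃ s ∈ S, i = s.castSucc})
        have h2 : y ∈ S' := Submodule.subset_span ⟨Fin.last m, Or.inl rfl, by simp⟩
        have h1 : U ⊓ W₀ ≤ S' := by
          rw [← hS, Submodule.span_le]
          rintro _ ⟨s, hs, rfl⟩
          exact Submodule.subset_span ⟨s.castSucc, Or.inr ⟨s, hs, rfl⟩, by simp⟩
        have h3 : u - g u • y ∈ U ⊓ W₀ :=
          ⟨U.sub_mem hu (U.smul_mem _ hyU), hdec u (hCW U hU hu).1⟩
        simpa using S'.add_mem (h1 h3) (S'.smul_mem (g u) h2)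
  · obtain ⟨y, x, hyW, hyv, hyC, hxW, hxx, hxy⟩ : ∃ y x, y ∈ W ∧ (∀ v ∈ W, b y v = 0) ∧
        (∀ U ∈ C, U ≠ ⊥ → y ∈ U) ∧ x ∈ W ∧ b x x = 0 ∧ b x y = 1 := by
      push Not at hright
      obtain ⟨w, hwW, hwy⟩ := hright
      have h1 : b w ((b w y)⁻¹ • y) = 1 := by simp [hwy]
      refine ⟨(b w y)⁻¹ • y, w - b w w • ((b w y)⁻¹ • y), W.smul_mem _ hyW, fun v hv => ?_,
        fun U hU hU0 => U.smul_mem _ (hyC U hU hU0),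
        W.sub_mem hwW (W.smul_mem _ (W.smul_mem _ hyW)), ?_, ?_⟩
      · simp [hyv v hv]
      · simp [hyv w hwW, hyv y hyW, hwy]
      · simp [hyv y hyW, hwy]
    have hyy := hyv y hyW
    have hyx := hyv x hxW
    set W₀ := perpPair b W x y with hW₀
    have hW₀W : W₀ ≤ W := perpPair_le b W x y
    have hdec : ∀ v ∈ W, ∃ α β : k, v - α • x - β • y ∈ W₀ := fun v hv => by
      obtain ⟨α, hα⟩ := hσs (b v y)
      exact ⟨α, b x v, sub_sub_mem_perpPair hxW hyW hxx hxy hyy hv hα⟩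
    have hfr := finrank_perpPair hxW hyW hxx hxy
    rw [← hW₀, hn] at hfr
    obtain ⟨m, e, R, hm, hspan, hR, hgram, hflag⟩ := ih _ (by omega) W₀
      ((· ⊓ W₀) '' insert (leftRadical b W) C)
      (isChain_image_inf (hC.insert fun U hU _ => Or.inr (hCW U hU)) W₀) (by
        rintro _ ⟨U, hU, rfl⟩ u ⟨huU, huW₀⟩
        have huR : u ∈ leftRadical b W := by
          obtain rfl | hU := hU
          · exact huU
          · exact hCW U hU huU
        exact ⟨huW₀, fun v hv => huR.2 v (hW₀W hv)⟩) rfl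
    have hli : LinearIndependent k e := by
      rw [linearIndependent_iff_card_le_finrank_span, Set.finrank, hspan, Fintype.card_fin]
      exact hm
    have heW₀ : ∀ j, e j ∈ W₀ := fun j => hspan ▸ Submodule.subset_span ⟨j, rfl⟩
    have hxe : ∀ j, b x (e j) = 0 := fun j => (mem_perpPair.1 (heW₀ j)).2.1
    have hey : ∀ j, b (e j) y = 0 := fun j => (mem_perpPair.1 (heW₀ j)).2.2
    have hye : ∀ j, b y (e j) = 0 := fun j => hyv _ (hW₀W (heW₀ j))
    obtain ⟨S₀, hS₀up, hS₀⟩ := hflag _ ⟨_, Set.mem_insert _ _, rfl⟩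
    change _ = leftRadical b W ⊓ W₀ at hS₀
    -- `T` consists of the index `i` with an entry `b (e i) x` that cannot be removed, if there is
    -- one.
    let T : Fin m → Prop := fun i => (¬ ∃ j, R i j) ∧ b (e i) x ≠ 0
    have hTS : ∀ i, T i → i ∉ S₀ := fun i hi hiS => by
      have h1 : e i ∈ leftRadical b W ⊓ W₀ := hS₀ ▸ Submodule.subset_span ⟨i, hiS, rfl⟩
      exact hi.2 (h1.1.2 x hxW)
    have hT : ∀ i, T i → ∀ i', i' < i ↔ ∃ j, R i' j := by
      intro i hi i'
      refine ⟨fun hlt => ?_, fun h => not_le.1 fun hle => hi.1 (hR.exists_of_le hle h)⟩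
      by_contra hi'
      -- The combination of `e i'` and `e i` killed by `b · x` lies in the left radical of `W`,
      -- hence in the span of the `e s` with `s ∈ S₀`, although `i' ∉ S₀`.
      obtain ⟨c, hc⟩ := hσs (b (e i') x / b (e i) x)
      have hz₀ : e i' - c • e i ∈ W₀ := W₀.sub_mem (heW₀ _) (W₀.smul_mem _ (heW₀ _))
      have hz : e i' - c • e i ∈ leftRadical b W := by
        refine ⟨hW₀W hz₀, fun v hv => ?_⟩
        have hzx : b (e i' - c • e i) x = 0 := by
          simp [hc, div_mul_cancel₀ _ hi.2]
        have hzW₀ : ∀ w ∈ W₀, b (e i' - c • e i) w = 0 := by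
          intro w hw
          rw [← hspan] at hw
          induction hw using Submodule.span_induction with
          | mem w hw =>
            obtain ⟨j, rfl⟩ := hw
            simp [hgram, if_neg (fun h => hi' ⟨j, h⟩), if_neg (fun h => hi.1 ⟨j, h⟩)]
          | zero => simp
          | add u v _ _ hu hv => rw [map_add, hu, hv, add_zero]
          | smul c u _ hu => rw [map_smul, hu, smul_zero]
        obtain ⟨α, β, h⟩ := hdec v hv
        have h1 := hzW₀ _ h
        rwa [map_sub, map_sub, map_smul, map_smul, hzx, (mem_perpPair.1 hz₀).2.2, smul_zero,
          smul_zero, sub_zero, sub_zero] at h1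
      have hzS : e i' - c • e i ∈ Submodule.span k (e '' S₀) := hS₀ ▸ ⟨hz, hz₀⟩
      have hi'S : i' ∉ S₀ := fun h => hTS i hi (hS₀up hlt.le h)
      refine hli.notMem_span_image (s := {i'}ᶜ) (x := i') (by simp) ?_
      have h1 := Submodule.span_mono (Set.image_mono (f := e)
        (show S₀ ⊆ {i'}ᶜ from fun s hs h => hi'S (h ▸ hs))) hzS
      have h2 : e i ∈ Submodule.span k (e '' {i'}ᶜ) :=
        Submodule.subset_span ⟨i, hlt.ne', rfl⟩
      simpa using Submodule.add_mem _ h1 (Submodule.smul_mem _ c h2)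
    -- Scaling `x` by `a` makes the remaining entry `1`; scaling `y` by `(σ a)⁻¹` keeps `b x y = 1`.
    obtain ⟨a, ha, haT⟩ : ∃ a : k, a ≠ 0 ∧ ∀ i, T i → a * b (e i) x = 1 := by
      by_cases hex : ∃ i, T i
      · obtain ⟨i, hi⟩ := hex
        refine ⟨(b (e i) x)⁻¹, inv_ne_zero hi.2, fun i' hi' => ?_⟩
        have : i' = i := by
          refine le_antisymm (not_lt.1 fun h => hi.1 ((hT i' hi' i).1 h))
            (not_lt.1 fun h => hi'.1 ((hT i hi i').1 h))
        rw [this, inv_mul_cancel₀ hi.2]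
      · exact ⟨1, one_ne_zero, fun i hi => absurd ⟨i, hi⟩ hex⟩
    -- Adding `w` to `x` removes the entries `b (e i) x` in the non-zero rows and keeps the others.
    obtain ⟨w, hwW₀, hwR, hwN⟩ : ∃ w ∈ W₀, (∀ i, (∃ j, R i j) → b (e i) w = -b (e i) x) ∧
        ∀ i, (¬ ∃ j, R i j) → b (e i) w = 0 := by
      refine ⟨∑ j, (∑ i, if R i j then -b (e i) x else 0) • e j,
        W₀.sum_mem fun j _ => W₀.smul_mem _ (heW₀ j), ?_, ?_⟩
      · rintro i ⟨j, hj⟩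
        rw [map_sum, Finset.sum_eq_single j]
        · rw [map_smul, hgram, if_pos hj, Finset.sum_eq_single i]
          · simp [hj]
          · exact fun i' _ hi' => if_neg fun h => hi' (hR.left_unique h hj)
          · simp
        · intro j' _ hj'
          rw [map_smul, hgram, if_neg fun h => hj' (hR.right_unique h hj), smul_zero]
        · simp
      · intro i hi
        rw [map_sum]
        refine Finset.sum_eq_zero fun j _ => ?_
        rw [map_smul, hgram, if_neg fun h => hi ⟨j, h⟩, smul_zero]
    have hxw : b x w = 0 := (mem_perpPair.1 hwW₀).2.1
    have hwy : b w y = 0 := (mem_perpPair.1 hwW₀).2.2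
    have hyw : b y w = 0 := hyv _ (hW₀W hwW₀)
    have hσa : σ a ≠ 0 := (map_ne_zero σ).2 ha
    -- The multiples of `y` make the row of the first vector vanish, except for its last entry.
    obtain ⟨f, hf⟩ : ∃ f : Fin (m + 2) → V, f =
        Fin.cons (a • (x + w) + (-(a * b (x + w) (x + w))) • y)
          (Fin.snoc (fun j => e j + (-b w (e j)) • y) ((σ a)⁻¹ • y) : Fin (m + 1) → V) := ⟨_, rfl⟩
    refine ⟨m + 2, f, consSnocRel R T, by omega, hf ▸
      span_cons_snoc hxW hyW hW₀W hspan hwW₀ hdec ha (inv_ne_zero hσa)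
        (-(a * b (x + w) (x + w))) (fun j => -b w (e j)), hR.consSnocRel hT, fun i j => ?_,
      fun U hU => ?_⟩
    · rw [hf]
      induction i using Fin.cases with
      | zero =>
        induction j using Fin.cases with
        | zero =>
          rw [if_neg (consSnocRel_zero_zero R T)]
          simp [hyx, hxy, hyy, hwy, hyw, hxx, hxw]
          ring
        | succ j =>
          induction j using Fin.lastCases with
          | last =>
            rw [if_pos (consSnocRel_zero_last R T)]
            simp [hxy, hyy, hwy, inv_mul_cancel₀ hσa]
          | cast j =>
            rw [if_neg (consSnocRel_zero_succ R T j)]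
            simp [hxy, hyy, hwy, hxe, hye]
      | succ i =>
        induction i using Fin.lastCases with
        | last =>
          rw [if_neg (consSnocRel_last R T j)]
          induction j using Fin.cases with
          | zero => simp [hyx, hyy, hyw]
          | succ j =>
            induction j using Fin.lastCases with
            | last => simp [hyy]
            | cast j => simp [hyy, hye]
        | cast i =>
          induction j using Fin.cases with
          | zero =>
            simp only [consSnocRel_succ_zero]
            have h1 : b (e i) x + b (e i) w = if ∃ j, R i j then 0 else b (e i) x := by
              split_ifs with h
              · rw [hwR i h, add_neg_cancel]
              · rw [hwN i h, add_zero]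
            have h2 : a * (b (e i) x + b (e i) w) = if T i then 1 else 0 := by
              rw [h1]
              split_ifs with hD hi hi
              · exact absurd hD hi.1
              · rw [mul_zero]
              · exact haT i hi
              · rw [not_not.1 fun h => hi ⟨hD, h⟩, mul_zero]
            simpa [hyx, hyy, hyw, hey, mul_add] using h2
          | succ j =>
            induction j using Fin.lastCases with
            | last =>
              rw [if_neg (consSnocRel_succ_last R T i)]
              simp [hyy, hey]
            | cast j =>
              simp only [consSnocRel_succ_succ]
              simp [hyy, hey, hye, hgram]
    · by_cases hU0 : U = ⊥
      · exact ⟨∅, isUpperSet_empty, by simp [hU0]⟩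
      have hyU := hyC U hU hU0
      obtain ⟨S, hSup, hS⟩ := hflag _ ⟨U, Set.mem_insert_of_mem _ hU, rfl⟩
      change _ = U ⊓ W₀ at hS
      have hf_last : f (Fin.last m).succ = (σ a)⁻¹ • y := by simp [hf]
      have hf_cast : ∀ s : Fin m, f s.castSucc.succ = e s - b w (e s) • y := fun s => by
        simp [hf, sub_eq_add_neg]
      refine ⟨{i | i = (Fin.last m).succ ∨ ∃ s ∈ S, i = s.castSucc.succ}, ?_,
        le_antisymm ?_ ?_⟩
      · rintro i i' hii' hi
        induction i' using Fin.cases with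
        | zero =>
          rw [Fin.le_zero_iff.1 hii'] at hi
          exact hi
        | succ i' =>
          induction i' using Fin.lastCases with
          | last => exact Or.inl rfl
          | cast i' =>
            obtain rfl | ⟨s, hs, rfl⟩ := hi
            · exact absurd (Fin.castSucc_lt_last i') (not_lt.2 (Fin.succ_le_succ_iff.1 hii'))
            · exact Or.inr ⟨i', hSup (by simpa using hii') hs, rfl⟩
      · rw [Submodule.span_le]
        rintro _ ⟨_, rfl | ⟨s, hs, rfl⟩, rfl⟩
        · exact hf_last ▸ U.smul_mem _ hyU
        · have h1 : e s ∈ U ⊓ W₀ := hS ▸ Submodule.subset_span ⟨s, hs, rfl⟩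
          exact hf_cast s ▸ U.sub_mem h1.1 (U.smul_mem (b w (e s)) hyU)
      · intro u hu
        set S' := Submodule.span k (f '' {i | i = (Fin.last m).succ ∨ ∃ s ∈ S, i = s.castSucc.succ})
        have h2 : y ∈ S' := by
          have h3 := S'.smul_mem (σ a)
            (Submodule.subset_span ⟨(Fin.last m).succ, Or.inl rfl, hf_last⟩)
          simpa [smul_smul, mul_inv_cancel₀ hσa] using h3
        have h1 : U ⊓ W₀ ≤ S' := by
          rw [← hS, Submodule.span_le]
          rintro _ ⟨s, hs, rfl⟩
          have h3 := S'.add_mem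
            (Submodule.subset_span ⟨s.castSucc.succ, Or.inr ⟨s, hs, rfl⟩, hf_cast s⟩)
            (S'.smul_mem (b w (e s)) h2)
          simpa using h3
        have hur := hCW U hU hu
        have h3 : u - b x u • y ∈ U ⊓ W₀ := by
          refine ⟨U.sub_mem hu (U.smul_mem _ hyU), ?_⟩
          simpa using sub_sub_mem_perpPair (α := 0) hxW hyW hxx hxy hyy hur.1
            (by rw [map_zero, hur.2 y hyW])
        simpa using S'.add_mem (h1 h3) (S'.smul_mem (b x u) h2)

end Sesquilinear

/-! ### Matrices of Frobenius forms -/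

section

variable {k : Type*} [Field k] {N : ℕ}

/-- The non-zero rows of a sparse matrix are distinct standard basis vectors. -/
theorem rank_of_strictAnti {r : ℕ} (hrN : r ≤ N) {c : Fin r → Fin N} (hc : StrictAnti c)
    {B : Matrix (Fin N) (Fin N) k}
    (hB : ∀ i j : Fin N, B i j = if ∃ s : Fin r, (s : ℕ) = (i : ℕ) ∧ c s = j then 1 else 0) :
    B.rank = r := by
  have hrow : ∀ s : Fin r, B.row (Fin.castLE hrN s) = Pi.single (c s) 1 := by
    intro s
    ext j
    rw [Matrix.row, hB, Pi.single_apply]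
    congr 1
    simp [← Fin.ext_iff, eq_comm]
  have hspan : Submodule.span k (Set.range B.row) =
      Submodule.span k (Set.range fun s : Fin r => (Pi.single (c s) 1 : Fin N → k)) := by
    apply le_antisymm
    · rw [Submodule.span_le]
      rintro _ ⟨i, rfl⟩
      by_cases hi : (i : ℕ) < r
      · exact Submodule.subset_span ⟨⟨i, hi⟩, (hrow ⟨i, hi⟩).symm⟩
      · have h0 : B.row i = 0 := by
          ext j
          rw [Matrix.row, hB, if_neg]
          · rfl
          · rintro ⟨s, hs, -⟩
            exact hi (hs ▸ s.2)
        rw [h0]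
        exact Submodule.zero_mem _
    · rw [Submodule.span_le]
      rintro _ ⟨s, rfl⟩
      exact Submodule.subset_span ⟨_, hrow s⟩
  have hli : LinearIndependent k fun s : Fin r => (Pi.single (c s) 1 : Fin N → k) := by
    have := (Pi.basisFun k (Fin N)).linearIndependent.comp c hc.injective
    convert this using 1
    ext s : 1
    simp
  rw [Matrix.rank_eq_finrank_span_row, hspan, finrank_span_eq_card hli, Fintype.card_fin]

open MvPolynomial

theorem matrixForm_eq_dotProduct (q : ℕ) (A : Matrix (Fin N) (Fin N) k) :
    matrixForm q A = (fun i => (X i : MvPolynomial (Fin N) k) ^ q) ⬝ᵥ (A.map C).mulVec X := rfl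

theorem changeCoords_mul (g g' : GL (Fin N) k) (h : MvPolynomial (Fin N) k) :
    changeCoords g' (changeCoords g h) = changeCoords (g * g') h := by
  unfold changeCoords
  rw [← AlgHom.comp_apply]
  congr 1
  ext1 i
  simp only [AlgHom.comp_apply, aeval_X, map_sum, map_mul, algHom_C, algebraMap_eq,
    Units.val_mul, Matrix.mul_apply, Finset.mul_sum,
    Finset.sum_mul, mul_assoc]
  exact Finset.sum_comm

theorem changeCoords_matrixForm (p : ℕ) [Fact p.Prime] [CharP k p] (e : ℕ) (g : GL (Fin N) k)
    (A : Matrix (Fin N) (Fin N) k) :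
    changeCoords g (matrixForm (p ^ e) A) =
      matrixForm (p ^ e) ((g.1.map (iterateFrobenius k p e)).transpose * A * g.1) := by
  have h1 : ∀ i, (∑ j, C (g.1 i j) * X j : MvPolynomial (Fin N) k) ^ p ^ e =
      ((g.1.map (iterateFrobenius k p e)).map C).mulVec
        (fun i => (X i : MvPolynomial (Fin N) k) ^ p ^ e) i := by
    intro i
    rw [sum_pow_char_pow]
    simp [Matrix.mulVec, dotProduct, mul_pow, iterateFrobenius_def]
  have h2 : changeCoords g (matrixForm (p ^ e) A) =
      (((g.1.map (iterateFrobenius k p e)).map C).mulVec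
        (fun i => (X i : MvPolynomial (Fin N) k) ^ p ^ e)) ⬝ᵥ
        (A.map C).mulVec ((g.1.map C).mulVec X) := by
    simp only [changeCoords, matrixForm, map_sum, map_mul, map_pow, aeval_X, h1, algHom_C,
      algebraMap_eq]
    rfl
  rw [h2, matrixForm_eq_dotProduct, Matrix.map_mul, Matrix.map_mul, Matrix.transpose_map,
    ← Matrix.mulVec_mulVec, ← Matrix.mulVec_mulVec, Matrix.dotProduct_mulVec _ (Matrix.transpose _),
    Matrix.vecMul_transpose]

theorem mem_vars_matrixForm {q : ℕ} (hq : 2 ≤ q) {A : Matrix (Fin N) (Fin N) k} {i j : Fin N}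
    (h : A i j ≠ 0) : i ∈ (matrixForm q A).vars ∧ j ∈ (matrixForm q A).vars := by
  rw [← coeff_matrixForm hq A i j] at h
  have hs := mem_support_iff.2 h
  refine ⟨(mem_vars_iff_mem_support i).2 ⟨_, hs, ?_⟩, (mem_vars_iff_mem_support j).2 ⟨_, hs, ?_⟩⟩
  · simp [show q ≠ 0 by omega]
  · simp

/-- The sesquilinear form on the space of columns with Gram matrix `A`. -/
def toSesquilinear (σ : k →+* k) (A : Matrix (Fin N) (Fin N) k) :
    (Fin N → k) →ₛₗ[σ] (Fin N → k) →ₗ[k] k :=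
  LinearMap.mk₂'ₛₗ σ (RingHom.id k) (fun u v => (fun i => σ (u i)) ⬝ᵥ A.mulVec v)
    (fun u u' v => by
      rw [← add_dotProduct]
      congr 1
      ext i
      simp)
    (fun c u v => by
      rw [← smul_dotProduct]
      congr 1
      ext i
      simp)
    (fun u v v' => by rw [Matrix.mulVec_add, dotProduct_add])
    (fun c u v => by rw [Matrix.mulVec_smul, dotProduct_smul]; rfl)

theorem toSesquilinear_apply (σ : k →+* k) (A : Matrix (Fin N) (Fin N) k) (u v : Fin N → k) :
    toSesquilinear σ A u v = (fun i => σ (u i)) ⬝ᵥ A.mulVec v := rfl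

/-- The Gram matrix of the columns of `P`. -/
theorem transpose_mul_mul_apply (σ : k →+* k) (A P : Matrix (Fin N) (Fin N) k) (i j : Fin N) :
    ((P.map σ).transpose * A * P) i j = toSesquilinear σ A (P.col i) (P.col j) := by
  rw [Matrix.mul_assoc]
  rfl

theorem rank_transpose_mul_mul (σ : k →+* k) (A : Matrix (Fin N) (Fin N) k)
    (g : GL (Fin N) k) : ((g.1.map σ).transpose * A * g.1).rank = A.rank := by
  have hg : IsUnit g.1.det := (Matrix.isUnit_iff_isUnit_det _).1 g.isUnit
  rw [Matrix.rank_mul_eq_left_of_isUnit_det _ _ hg, Matrix.rank_mul_eq_right_of_isUnit_det]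
  rw [Matrix.det_transpose, ← RingHom.mapMatrix_apply, ← RingHom.map_det]
  exact hg.map σ

/-- A matrix with entries only in the rows and columns of `T` is equivalent to a sparse one: a
sparse basis of the span of the basis vectors in `T` is completed by the other basis vectors. -/
theorem exists_isSparse [IsAlgClosed k] {σ : k →+* k} {q : ℕ} (hq : 2 ≤ q)
    (hσ : ∀ x, σ x = x ^ q) (A : Matrix (Fin N) (Fin N) k) (T : Finset (Fin N))
    (hT : ∀ i j, A i j ≠ 0 → i ∈ T ∧ j ∈ T) :
    ∃ g : GL (Fin N) k,
      IsSparse T.card A.rank ((g.1.map σ).transpose * A * g.1) := by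
  classical
  set b := toSesquilinear σ A
  have hbl : ∀ i ∉ T, ∀ v, b (Pi.single i 1) v = 0 := by
    intro i hi v
    rw [toSesquilinear_apply]
    refine Finset.sum_eq_zero fun i' _ => ?_
    by_cases h : i' = i
    · subst h
      have : A i' = 0 := funext fun j => not_not.1 fun h => hi (hT _ _ h).1
      simp [Matrix.mulVec, this]
    · simp [h]
  have hbr : ∀ i ∉ T, ∀ v, b v (Pi.single i 1) = 0 := by
    intro i hi v
    rw [toSesquilinear_apply]
    refine Finset.sum_eq_zero fun i' _ => ?_
    have : A i' i = 0 := not_not.1 fun h => hi (hT _ _ h).2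
    simp [this]
  set W := Submodule.span k (Set.range fun i : T => (Pi.single (i : Fin N) 1 : Fin N → k)) with hW
  have hWfr : Module.finrank k W = T.card := by
    have hli : LinearIndependent k fun i : T => (Pi.single (i : Fin N) 1 : Fin N → k) := by
      have := (Pi.basisFun k (Fin N)).linearIndependent.comp ((↑) : T → Fin N)
        Subtype.val_injective
      convert this using 1
      ext s : 1
      simp
    rw [hW, finrank_span_eq_card hli, Fintype.card_coe]
  obtain ⟨m, e, R, hm, hspan, hR, hgram, -⟩ := exists_sparse hq hσ b W ∅ (by simp) (by simp)
  have hmT : m = T.card := by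
    refine le_antisymm (hWfr ▸ hm) ?_
    rw [← hWfr, ← hspan]
    exact (finrank_range_le_card (R := k) e).trans_eq (Fintype.card_fin m)
  have hmN : m ≤ N := by
    rw [hmT]
    simpa using T.card_le_univ
  obtain ⟨ε⟩ : Nonempty (Fin (N - m) ≃ {i // i ∉ T}) := by
    refine ⟨(Fintype.equivFinOfCardEq ?_).symm⟩
    rw [Fintype.card_subtype_compl, Fintype.card_fin, Fintype.card_coe, hmT]
  let f : Fin N → Fin N → k := fun x =>
    if hx : (x : ℕ) < m then e ⟨x, hx⟩ else Pi.single (ε ⟨x - m, by omega⟩ : Fin N) 1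
  have hfe : ∀ i : Fin m, f (Fin.castLE hmN i) = e i := fun i => by simp [f]
  have hfz : ∀ x : Fin N, m ≤ (x : ℕ) → ∃ i ∉ T, f x = Pi.single i 1 := fun x hx =>
    ⟨_, (ε ⟨x - m, by omega⟩).2, dif_neg (not_lt.2 hx)⟩
  have hftop : ⊤ ≤ Submodule.span k (Set.range f) := by
    rw [← (Pi.basisFun k (Fin N)).span_eq, Submodule.span_le]
    rintro _ ⟨i, rfl⟩
    rw [Pi.basisFun_apply]
    by_cases hi : i ∈ T
    · have h1 : W ≤ Submodule.span k (Set.range f) := by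
        rw [← hspan]
        refine Submodule.span_mono ?_
        rintro _ ⟨j, rfl⟩
        exact ⟨_, hfe j⟩
      exact h1 (Submodule.subset_span ⟨⟨i, hi⟩, rfl⟩)
    · refine Submodule.subset_span ⟨⟨m + ε.symm ⟨i, hi⟩, by omega⟩, ?_⟩
      simp [f]
  have hfli : LinearIndependent k f :=
    linearIndependent_of_top_le_span_of_card_eq_finrank hftop (by simp)
  let P : Matrix (Fin N) (Fin N) k := (Matrix.of f).transpose
  have hP : IsUnit P := Matrix.linearIndependent_cols_iff_isUnit.1 hfli
  obtain ⟨g, hg⟩ := hP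
  obtain ⟨r, c, hc, hrm, hRc⟩ := hR.exists_strictAnti
  set B := (P.map σ).transpose * A * P with hB
  have hBb : ∀ i j, B i j = b (f i) (f j) := fun i j => transpose_mul_mul_apply σ A P i j
  have hBc : ∀ i j : Fin N, B i j =
      if ∃ s : Fin r, (s : ℕ) = (i : ℕ) ∧ Fin.castLE hmN (c s) = j then 1 else 0 := by
    intro i j
    rw [hBb]
    by_cases hi : (i : ℕ) < m
    · by_cases hj : (j : ℕ) < m
      · obtain ⟨i, rfl⟩ : ∃ i' : Fin m, i = Fin.castLE hmN i' := ⟨⟨i, hi⟩, rfl⟩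
        obtain ⟨j, rfl⟩ : ∃ j' : Fin m, j = Fin.castLE hmN j' := ⟨⟨j, hj⟩, rfl⟩
        rw [hfe, hfe, hgram]
        simp only [hRc, Fin.val_castLE, Fin.castLE_inj]
      · obtain ⟨l, hl, h⟩ := hfz j (not_lt.1 hj)
        rw [h, hbr l hl, if_neg]
        rintro ⟨s, -, rfl⟩
        exact hj (c s).2
    · obtain ⟨l, hl, h⟩ := hfz i (not_lt.1 hi)
      rw [h, hbl l hl, if_neg]
      rintro ⟨s, hs, -⟩
      exact hi (hs ▸ s.2.trans_le hrm)
  have hcN : StrictAnti fun s => Fin.castLE hmN (c s) := fun s s' h => hc h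
  have hrank : A.rank = r := by
    rw [← rank_of_strictAnti (hrm.trans hmN) hcN hBc, hB, ← hg]
    exact (rank_transpose_mul_mul σ A g).symm
  refine ⟨g, ?_⟩
  rw [hg, ← hB, hrank, ← hmT]
  refine ⟨fun i j hi => ?_, fun i j hj => ?_, _, hcN, hBc⟩
  · rw [hBc, if_neg]
    rintro ⟨s, hs, -⟩
    exact absurd (hs ▸ s.2) (not_lt.2 hi)
  · rw [hBc, if_neg]
    rintro ⟨s, -, rfl⟩
    exact absurd (c s).2 (not_lt.2 hj)

end
end FrobeniusForms

theorem theorem7p2 {k : Type*} [Field k] [IsAlgClosed k] (p : ℕ) [Fact p.Prime] [CharP k p]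
    (e : ℕ) (he : 0 < e) (N n r : ℕ) (h : MvPolynomial (Fin N) k)
    (hh : FrobeniusForms.IsFrobeniusForm (p ^ e) h)
    (hn : FrobeniusForms.embDim h = n) (hr : FrobeniusForms.rank (p ^ e) h = r) :
    ∃ (g : GL (Fin N) k) (B : Matrix (Fin N) (Fin N) k),
      FrobeniusForms.Represents (p ^ e) B (FrobeniusForms.changeCoords g h) ∧
        FrobeniusForms.IsSparse n r B := by
  have hq : 2 ≤ p ^ e :=
    (Fact.out : p.Prime).two_le.trans (Nat.le_self_pow he.ne' p)
  have hA := (FrobeniusForms.represents_iff hq hh _).2 rfl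
  obtain ⟨g₀, hg₀⟩ := ciInf_mem fun g : GL (Fin N) k => (FrobeniusForms.changeCoords g h).vars.card
  set A := FrobeniusForms.formMatrix (p ^ e) h
  rw [FrobeniusForms.Represents] at hA
  have h₁ := FrobeniusForms.changeCoords_matrixForm p e g₀ A
  rw [← hA] at h₁
  obtain ⟨g, hg⟩ := FrobeniusForms.exists_isSparse hq (σ := iterateFrobenius k p e)
    (fun x => iterateFrobenius_def p e x) _ (FrobeniusForms.changeCoords g₀ h).vars
    (fun i j hij => by rw [h₁]; exact FrobeniusForms.mem_vars_matrixForm hq hij)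
  refine ⟨g₀ * g, (g.1.map (iterateFrobenius k p e)).transpose *
    ((g₀.1.map (iterateFrobenius k p e)).transpose * A * g₀.1) * g.1, ?_, ?_⟩
  · rw [← FrobeniusForms.changeCoords_mul, h₁]
    exact FrobeniusForms.changeCoords_matrixForm p e g _
  · convert hg using 1
    · rw [← hn]
      exact hg₀.symm
    · rw [← hr]
      exact (FrobeniusForms.rank_transpose_mul_mul _ A g₀).symm
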